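/- Theorem (Stone–von Neumann). Let $d\in\mathbb N$ and let $\sigma$ be the symplectic form on $\mathbb R^{2d}=\mathbb R^d\times\mathbb R^d$ given by $\sigma\big((\alpha,\beta),(\gamma,\delta)\big)=\alpha\cdot\delta-\gamma\cdot\beta$. Let $\mathfrak W$ be the Weyl algebra over $\mathbb R^{2d}$ (with $\hbar=1$), i.e. a unital $C^\star$-algebra containing nonzero elements $W(v)$, $v\in\mathbb R^{2d}$, which satisfy the Weyl relations $$W(v)^\star=W(-v),\qquad W(v)W(w)=e^{-\imath\sigma(v,w)/2}\,W(v+w)\qquad(v,w\in\mathbb R^{2d}),$$ and whose finite complex linear combinations are norm dense in $\mathfrak W$. A representation of $\mathfrak W$ on a complex Hilbert space $H$ is a unital $\star$-homomorphism $\pi\colon\mathfrak W\to B(H)$. It is called regular if $v\mapsto\pi(W(v))$ is strongly continuous, i.e. $v\mapsto\pi(W(v))x$ is norm continuous on $\mathbb R^{2d}$ for every $x\in H$, and irreducible if $H\neq\{0\}$ and the only closed $\pi(\mathfrak W)$-invariant linear subspaces of $H$ are $\{0\}$ and $H$. Then any two regular irreducible representations $\pi$ of $\mathfrak W$ on $H$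 and $\varphi$ of $\mathfrak W$ on $K$ are unitarily equivalent: there is a unitary operator $U\colon H\to K$ with $\varphi(A)=U\pi(A)U^\star$ for all $A\in\mathfrak W$. -/

import Mathlib

/-- The phase space `ℝ^d × ℝ^d = ℝ^{2d}`; its points are `v = (α, β)`. -/
abbrev PhaseSpace (d : ℕ) : Type :=
  EuclideanSpace ℝ (Fin d) × EuclideanSpace ℝ (Fin d)

/-- The standard symplectic form `σ((α, β), (γ, δ)) = α · δ - γ · β`. -/
noncomputable def symplecticForm {d : ℕ} (v w : PhaseSpace d) : ℝ :=
  inner ℝ v.1 w.2 - inner ℝ w.1 v.2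

/-- The (unital) C⋆-algebra `A` together with the family `W` is (a copy of) the Weyl algebra over
`ℝ^{2d}`: the `W v` are nonzero, satisfy the Weyl relations (with `ħ = 1`), and generate `A`,
i.e. every element of `A` is a norm limit of finite linear combinations of the `W v`. The span here
is the plain linear span, which is not enlarged by the unit of `A`; that `W 0 = 1` is therefore a
consequence. -/
structure IsWeylAlgebra {d : ℕ} {A : Type*} [CStarAlgebra A] (W : PhaseSpace d → A) : Prop where
  ne_zero : ∀ v, W v ≠ 0
  star_weyl : ∀ v, star (W v) = W (-v)
  weyl_mul : ∀ v w,
    W v * W w = Complex.exp (-(Complex.I * (symplecticForm v w : ℂ) / 2)) • W (v + w)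
  dense_span : Dense (Submodule.span ℂ (Set.range W) : Set A)

section Representations

variable {A : Type*} [CStarAlgebra A]
  {H : Type*} [NormedAddCommGroup H] [InnerProductSpace ℂ H] [CompleteSpace H]
  {K : Type*} [NormedAddCommGroup K] [InnerProductSpace ℂ K] [CompleteSpace K]

/-- A representation `π` of a C⋆-algebra on a Hilbert space `H` is irreducible if `H ≠ 0` and the
only closed subspaces of `H` invariant under all `π a` are `0` and `H`. -/
def IsIrreducibleRep (π : A →⋆ₐ[ℂ] (H →L[ℂ] H)) : Prop :=
  Nontrivial H ∧
    ∀ L : Submodule ℂ H, IsClosed (L : Set H) → (∀ a : A, ∀ x ∈ L, π a x ∈ L) → L = ⊥ ∨ L = ⊤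

/-- A representation `π` is regular (with respect to the Weyl elements `W`) if `v ↦ π (W v)` is
continuous for the strong operator topology. -/
def IsRegularRep {d : ℕ} (W : PhaseSpace d → A) (π : A →⋆ₐ[ℂ] (H →L[ℂ] H)) : Prop :=
  ∀ x : H, Continuous fun v : PhaseSpace d => π (W v) x

/-- Two representations `π` on `H` and `φ` on `K` are unitarily equivalent if there is a unitary
`U : H → K` with `φ a = U (π a) U⋆` for all `a`. -/
def UnitarilyEquivalent (π : A →⋆ₐ[ℂ] (H →L[ℂ] H)) (φ : A →⋆ₐ[ℂ] (K →L[ℂ] K)) : Prop :=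
  ∃ U : H ≃ₗᵢ[ℂ] K, ∀ (a : A) (y : K), φ a y = U (π a (U.symm y))

end Representations

/-! ### The Weyl algebra exists

The concrete model is the closed linear span of the twisted translations
`(W(v) f)(u) = exp(-i σ(v, u) / 2) f(u - v)` on `ℓ²(ℝ^{2d})`. -/

namespace WeylModel

/-- The phase `exp(-i t / 2)`. -/
noncomputable def phase (t : ℝ) : ℂ := Complex.exp (-(Complex.I * (t : ℂ) / 2))

lemma phase_add (s t : ℝ) : phase (s + t) = phase s * phase t := by
  simp only [phase, ← Complex.exp_add]; congr 1; push_cast; ring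

lemma norm_phase (t : ℝ) : ‖phase t‖ = 1 := by
  rw [phase, show -(Complex.I * (t : ℂ) / 2) = ((-(t / 2) : ℝ) : ℂ) * Complex.I by
    push_cast; ring]
  exact Complex.norm_exp_ofReal_mul_I _

variable {d : ℕ}

/-- The Hilbert space `ℓ²(ℝ^{2d})` (functions on the discrete set `ℝ^{2d}`). -/
abbrev Space (d : ℕ) : Type := lp (fun _ : PhaseSpace d => ℂ) 2

lemma memℓp_twist (v : PhaseSpace d) (f : Space d) :
    Memℓp (fun u : PhaseSpace d => phase (symplecticForm v u) * f (u - v)) 2 := by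
  have hf := (memℓp_gen_iff (p := 2) (by norm_num)).1 (lp.memℓp f)
  refine (memℓp_gen_iff (p := 2) (by norm_num)).2 ?_
  simp only [norm_mul, norm_phase, one_mul]
  exact (Equiv.subRight v).summable_iff.2 hf

/-- The twisted translation as a linear map. -/
noncomputable def twist (v : PhaseSpace d) : Space d →ₗ[ℂ] Space d where
  toFun f := ⟨fun u => phase (symplecticForm v u) * f (u - v), memℓp_twist v f⟩
  map_add' f g := by
    ext u
    show phase _ * (f (u - v) + g (u - v)) = phase _ * f (u - v) + phase _ * g (u - v)
    ring
  map_smul' c f := by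
    ext u
    show phase _ * (c * f (u - v)) = c * (phase _ * f (u - v))
    ring

lemma twist_apply (v : PhaseSpace d) (f : Space d) (u : PhaseSpace d) :
    twist v f u = phase (symplecticForm v u) * f (u - v) := rfl

lemma norm_twist (v : PhaseSpace d) (f : Space d) : ‖twist v f‖ = ‖f‖ := by
  rw [lp.norm_eq_tsum_rpow (by norm_num), lp.norm_eq_tsum_rpow (by norm_num)]
  congr 1
  simp only [twist_apply, norm_mul, norm_phase, one_mul]
  exact (Equiv.subRight v).tsum_eq (fun u => ‖f u‖ ^ (2 : ENNReal).toReal)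

/-- The twisted translation as a bounded operator. -/
noncomputable def op (v : PhaseSpace d) : Space d →L[ℂ] Space d :=
  (twist v).mkContinuous 1 fun f => by rw [norm_twist, one_mul]

lemma op_apply (v : PhaseSpace d) (f : Space d) (u : PhaseSpace d) :
    op v f u = phase (symplecticForm v u) * f (u - v) := rfl

lemma op_mul (v w : PhaseSpace d) :
    op v * op w = phase (symplecticForm v w) • op (v + w) := by
  ext f u
  show op v (op w f) u = phase (symplecticForm v w) * op (v + w) f u
  simp only [op_apply, ← mul_assoc, ← phase_add]
  rw [show u - (v + w) = u - v - w by abel]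
  congr 2
  simp only [symplecticForm, Prod.fst_sub, Prod.snd_sub, Prod.fst_add, Prod.snd_add,
    inner_sub_left, inner_sub_right, inner_add_left, inner_add_right]
  ring

lemma op_zero : op (0 : PhaseSpace d) = 1 := by
  ext f u
  show op 0 f u = f u
  simp [op_apply, symplecticForm, phase]

lemma symplecticForm_neg_right (v : PhaseSpace d) : symplecticForm v (-v) = 0 := by
  simp [symplecticForm]

lemma op_mul_op_neg (v : PhaseSpace d) : op v * op (-v) = 1 := by
  rw [op_mul, add_neg_cancel, op_zero, symplecticForm_neg_right]
  simp [phase]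

lemma star_op (v : PhaseSpace d) : star (op v) = op (-v) := by
  have h1 : star (op v) * op v = 1 := by
    rw [ContinuousLinearMap.star_eq_adjoint]
    exact (ContinuousLinearMap.norm_map_iff_adjoint_comp_self _).1 (norm_twist v)
  exact left_inv_eq_right_inv h1 (op_mul_op_neg v)

lemma one_ne_zero_op : (1 : Space d →L[ℂ] Space d) ≠ 0 := by
  classical
  intro h
  have h2 := congrArg (fun T : Space d →L[ℂ] Space d => T (lp.single 2 0 1) 0) h
  simp at h2

lemma op_ne_zero (v : PhaseSpace d) : op v ≠ 0 := fun h =>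
  one_ne_zero_op (d := d) (by rw [← op_mul_op_neg v, h, zero_mul])

/-- The linear span of the twisted translations, as a star subalgebra. -/
noncomputable def preAlgebra (d : ℕ) : StarSubalgebra ℂ (Space d →L[ℂ] Space d) where
  carrier := (Submodule.span ℂ (Set.range (op (d := d))) : Set _)
  mul_mem' {a b} ha hb := by
    induction ha using Submodule.span_induction with
    | mem x hx =>
      obtain ⟨v, rfl⟩ := hx
      induction hb using Submodule.span_induction with
      | mem y hy =>
        obtain ⟨w, rfl⟩ := hy
        rw [op_mul]
        exact Submodule.smul_mem _ _ (Submodule.subset_span ⟨_, rfl⟩)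
      | zero => rw [mul_zero]; exact Submodule.zero_mem _
      | add x y _ _ hx hy => rw [mul_add]; exact Submodule.add_mem _ hx hy
      | smul c x _ hx => rw [mul_smul_comm]; exact Submodule.smul_mem _ _ hx
    | zero => rw [zero_mul]; exact Submodule.zero_mem _
    | add x y _ _ hx hy => rw [add_mul]; exact Submodule.add_mem _ hx hy
    | smul c x _ hx => rw [smul_mul_assoc]; exact Submodule.smul_mem _ _ hx
  add_mem' ha hb := Submodule.add_mem _ ha hb
  algebraMap_mem' c := by
    rw [Algebra.algebraMap_eq_smul_one, ← op_zero]
    exact Submodule.smul_mem _ _ (Submodule.subset_span ⟨_, rfl⟩)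
  star_mem' {a} ha := by
    induction ha using Submodule.span_induction with
    | mem x hx =>
      obtain ⟨v, rfl⟩ := hx
      rw [star_op]
      exact Submodule.subset_span ⟨_, rfl⟩
    | zero => rw [star_zero]; exact Submodule.zero_mem _
    | add x y _ _ hx hy => rw [star_add]; exact Submodule.add_mem _ hx hy
    | smul c x _ hx => rw [star_smul]; exact Submodule.smul_mem _ _ hx

/-- The concrete Weyl algebra over `ℝ^{2d}`. -/
noncomputable abbrev weylAlgebra (d : ℕ) : StarSubalgebra ℂ (Space d →L[ℂ] Space d) :=
  (preAlgebra d).topologicalClosure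

noncomputable instance (d : ℕ) : CStarAlgebra (weylAlgebra d) :=
  StarSubalgebra.cstarAlgebra (weylAlgebra d) (h_closed := (preAlgebra d).isClosed_topologicalClosure)

/-- The Weyl elements of the concrete Weyl algebra. -/
noncomputable def weyl (v : PhaseSpace d) : weylAlgebra d :=
  ⟨op v, (preAlgebra d).le_topologicalClosure (Submodule.subset_span ⟨v, rfl⟩)⟩

theorem isWeylAlgebra (d : ℕ) : IsWeylAlgebra (weyl (d := d)) where
  ne_zero v h := op_ne_zero v (congrArg Subtype.val h)
  star_weyl v := Subtype.ext (star_op v)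
  weyl_mul v w := Subtype.ext (op_mul v w)
  dense_span := by
    rw [Subtype.dense_iff]
    intro x hx
    refine closure_mono ?_ hx
    intro y hy
    change y ∈ Submodule.span ℂ (Set.range (op (d := d))) at hy
    induction hy using Submodule.span_induction with
    | mem x hx =>
      obtain ⟨v, rfl⟩ := hx
      exact ⟨weyl v, Submodule.subset_span ⟨v, rfl⟩, rfl⟩
    | zero => exact ⟨0, Submodule.zero_mem _, rfl⟩
    | add x y _ _ hx hy =>
      obtain ⟨a, ha, rfl⟩ := hx
      obtain ⟨b, hb, rfl⟩ := hy
      exact ⟨a + b, Submodule.add_mem _ ha hb, rfl⟩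
    | smul c x _ hx =>
      obtain ⟨a, ha, rfl⟩ := hx
      exact ⟨c • a, Submodule.smul_mem _ c ha, rfl⟩

end WeylModel

/-!
Von Neumann's argument: a regular representation contains a vacuum vector, and the vacuum state
determines an irreducible representation up to unitary equivalence.

In the Euclidean structure of `ℝ^{2d}` the symplectic form is `(v, w) ↦ ⟪J v, w⟫` with the isometry
`J (α, β) = (-β, α)`. For `T v = π (W v)` consider the operator
`P x = ∫ exp(-‖v‖² / 4) T(v) x dv`. Completing the square in a Gaussian integral gives
`P T(u) P = c exp(-‖u‖² / 4) P` (`IsWeylSystem.gaussianAverage_apply_gaussianAverage`). Moreover `P`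
is symmetric, and it is nonzero because the vectors `T(-u) P T(u) x` are the values of the Fourier
transform of the continuous integrable function `v ↦ exp(-‖v‖² / 4) T(v) x`, whose value at `0` is `x`
(`IsWeylSystem.exists_gaussianAverage_ne_zero`). Hence a normalised vector `Ω` in the range of `P`
satisfies `⟪Ω, T(u) Ω⟫ = exp(-‖u‖² / 4)` for all `u` (`IsWeylSystem.exists_vacuum`).

The right-hand side does not depend on the representation. Since the linear combinations of the
`W v` are dense, the vacuum vectors `Ω` of `π` and `Ψ` of `φ` define the same state on the Weyl
algebra. By irreducibility both are cyclic, and `π a Ω ↦ φ a Ψ` extends to the required unitary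
(`unitarilyEquivalent_of_vectorState_eq`).
-/

open MeasureTheory WeylModel

/-! ### Cyclic representations with the same vector state -/

section Cyclic

variable {A : Type*} [CStarAlgebra A]
  {H : Type*} [NormedAddCommGroup H] [InnerProductSpace ℂ H] [CompleteSpace H]
  {K : Type*} [NormedAddCommGroup K] [InnerProductSpace ℂ K] [CompleteSpace K]

/-- The orbit map `a ↦ π a Ω`. -/
noncomputable def orbitMap (π : A →⋆ₐ[ℂ] (H →L[ℂ] H)) (Ω : H) : A →ₗ[ℂ] H where
  toFun a := π a Ω
  map_add' a b := by simp
  map_smul' c a := by simp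

lemma orbitMap_apply (π : A →⋆ₐ[ℂ] (H →L[ℂ] H)) (Ω : H) (a : A) : orbitMap π Ω a = π a Ω := rfl

lemma continuous_rep (π : A →⋆ₐ[ℂ] (H →L[ℂ] H)) : Continuous π :=
  AddMonoidHomClass.continuous_of_bound π 1 fun a => by
    simpa using NonUnitalStarAlgHom.norm_apply_le π a

lemma IsIrreducibleRep.denseRange_orbitMap {π : A →⋆ₐ[ℂ] (H →L[ℂ] H)} (hπ : IsIrreducibleRep π)
    {Ω : H} (hΩ : Ω ≠ 0) : DenseRange (orbitMap π Ω) := by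
  have hinv : ∀ a : A, ∀ x ∈ (LinearMap.range (orbitMap π Ω)).topologicalClosure,
      π a x ∈ (LinearMap.range (orbitMap π Ω)).topologicalClosure := by
    intro a x hx
    refine map_mem_closure (π a).continuous hx ?_
    rintro _ ⟨b, rfl⟩
    exact ⟨a * b, by simp [orbitMap_apply]⟩
  have hmem : Ω ∈ (LinearMap.range (orbitMap π Ω)).topologicalClosure :=
    Submodule.le_topologicalClosure _ ⟨1, by simp [orbitMap_apply]⟩
  rcases hπ.2 _ (Submodule.isClosed_topologicalClosure _) hinv with h | h
  · rw [h] at hmem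
    exact absurd ((Submodule.mem_bot ℂ).1 hmem) hΩ
  · have := Submodule.dense_iff_topologicalClosure_eq_top.2 h
    rwa [LinearMap.coe_range] at this

lemma norm_sq_rep_apply (π : A →⋆ₐ[ℂ] (H →L[ℂ] H)) (Ω : H) (a : A) :
    ((‖π a Ω‖ ^ 2 : ℝ) : ℂ) = inner ℂ Ω (π (star a * a) Ω) := by
  rw [map_mul, map_star, ContinuousLinearMap.star_eq_adjoint, mul_apply_eq_comp,
    ContinuousLinearMap.adjoint_inner_right, inner_self_eq_norm_sq_to_K]
  push_cast
  rfl

/-- Uniqueness of the GNS construction: the unitary is the extension of `π a Ω ↦ φ a Ψ`. -/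
theorem unitarilyEquivalent_of_vectorState_eq {π : A →⋆ₐ[ℂ] (H →L[ℂ] H)}
    {φ : A →⋆ₐ[ℂ] (K →L[ℂ] K)} {Ω : H} {Ψ : K} (hΩ : DenseRange (orbitMap π Ω))
    (hΨ : DenseRange (orbitMap φ Ψ))
    (h : ∀ a, inner ℂ Ω (π a Ω) = inner ℂ Ψ (φ a Ψ)) : UnitarilyEquivalent π φ := by
  have hn : ∀ a, ‖orbitMap φ Ψ (LinearEquiv.refl ℂ A a)‖ = ‖orbitMap π Ω a‖ := by
    intro a
    have h2 : ‖φ a Ψ‖ ^ 2 = ‖π a Ω‖ ^ 2 := by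
      have := (norm_sq_rep_apply φ Ψ a).trans ((h _).symm.trans (norm_sq_rep_apply π Ω a).symm)
      exact_mod_cast this
    exact (sq_eq_sq₀ (norm_nonneg _) (norm_nonneg _)).1 h2
  let U : H ≃ₗᵢ[ℂ] K :=
    (LinearEquiv.refl ℂ A).extendOfIsometry (orbitMap π Ω) (orbitMap φ Ψ) hΩ hΨ hn
  have hU : ∀ a, U (π a Ω) = φ a Ψ := fun a =>
    LinearEquiv.extendOfIsometry_eq _ _ _ hΩ hΨ hn a
  refine ⟨U, fun a y => ?_⟩
  refine hΨ.induction_on (p := fun y => φ a y = U (π a (U.symm y))) y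
    (isClosed_eq (φ a).continuous (U.continuous.comp ((π a).continuous.comp U.symm.continuous)))
    fun b => ?_
  have hb : U.symm (φ b Ψ) = π b Ω := by rw [← hU b, U.symm_apply_apply]
  have h3 := hU (a * b)
  rw [map_mul, map_mul, mul_apply_eq_comp, mul_apply_eq_comp] at h3
  rw [orbitMap_apply, hb, h3]

end Cyclic

/-! ### Gaussian integrals -/

section Gaussian

variable {V : Type*} [NormedAddCommGroup V]

/-- The Gaussian `exp(-‖v‖² / 4)`, the characteristic function of the vacuum. -/
noncomputable def gaussian (v : V) : ℝ := Real.exp (-‖v‖ ^ 2 / 4)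

lemma gaussian_zero : gaussian (0 : V) = 1 := by simp [gaussian]

lemma gaussian_neg (v : V) : gaussian (-v) = gaussian v := by simp [gaussian]

lemma gaussian_pos (v : V) : 0 < gaussian v := Real.exp_pos _

lemma continuous_gaussian : Continuous (gaussian : V → ℝ) := by
  unfold gaussian; fun_prop

lemma continuous_phase : Continuous phase := by
  unfold phase; fun_prop

lemma phase_zero : phase 0 = 1 := by simp [phase]

variable [InnerProductSpace ℝ V] [FiniteDimensional ℝ V] [MeasurableSpace V] [BorelSpace V]

lemma integrable_gaussian : Integrable (gaussian : V → ℝ) := by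
  have h := (GaussianFourier.integrable_cexp_neg_mul_sq_norm_add (V := V) (b := 1 / 4)
    (by norm_num) 0 0).norm
  refine h.congr (Filter.Eventually.of_forall fun v => ?_)
  simp only [gaussian, Complex.norm_exp]
  congr 1
  have : (-(1 / 4 : ℂ) * (‖v‖ : ℂ) ^ 2 + 0 * ((inner ℝ 0 v : ℝ) : ℂ)) =
      ((-‖v‖ ^ 2 / 4 : ℝ) : ℂ) := by push_cast; ring
  rw [this, Complex.ofReal_re]

/-- The total mass `∫ exp(-‖v‖² / 2) dv`, in the form in which Gaussian integrals produce it. -/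
noncomputable def gaussianMass (V : Type*) [NormedAddCommGroup V] [InnerProductSpace ℝ V] : ℂ :=
  (Real.pi / (1 / 2 : ℂ)) ^ (Module.finrank ℝ V / 2 : ℂ)

/-- The twisted convolution of the Gaussian with its translate by `u` is a multiple of the
Gaussian. -/
lemma integral_gaussian_mul_gaussian_mul_phase (J : V →ₗᵢ[ℝ] V)
    (hJ : ∀ v w : V, inner ℝ (J v) w = -inner ℝ v (J w)) (u s : V) :
    ∫ v : V, ((gaussian v * gaussian (s - u - v) : ℝ) : ℂ) *
        phase (inner ℝ (J v) u + inner ℝ (J (v + u)) (s - u - v)) =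
      gaussianMass V * gaussian u * gaussian s := by
  obtain ⟨a, rfl⟩ : ∃ a, s = u + (a + a) :=
    ⟨(1 / 2 : ℝ) • (s - u), by rw [← add_smul]; norm_num⟩
  have hJ' : ∀ v w : V, inner ℝ (J v) w = -inner ℝ (J w) v := fun v w => by
    rw [hJ, real_inner_comm]
  have hJ0 : ∀ v : V, inner ℝ (J v) v = 0 := fun v => by linarith [hJ' v v]
  -- The translation by `a`, half of `s - u`, completes the square in the product of Gaussians.
  rw [← integral_add_right_eq_self _ a]
  have key : ∀ v : V,
      ((gaussian (v + a) * gaussian (u + (a + a) - u - (v + a)) : ℝ) : ℂ) *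
        phase (inner ℝ (J (v + a)) u +
          inner ℝ (J (v + a + u)) (u + (a + a) - u - (v + a))) =
      Complex.exp (-(‖a‖ ^ 2 / 2)) *
        Complex.exp (-(1 / 2 : ℂ) * (‖v‖ : ℂ) ^ 2 +
          Complex.I * ((inner ℝ (J (u + a)) v : ℝ) : ℂ)) := by
    intro v
    have e1 : u + (a + a) - u - (v + a) = a - v := by abel
    have e2 : inner ℝ (J (v + a)) u + inner ℝ (J (v + a + u)) (a - v) =
        -2 * inner ℝ (J (u + a)) v := by
      simp only [map_add, inner_add_left, inner_sub_right, hJ0]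
      rw [hJ' v u, hJ' v a, hJ' a u]
      ring
    have e3 : -‖v + a‖ ^ 2 / 4 + -‖a - v‖ ^ 2 / 4 = -(‖a‖ ^ 2 / 2) - ‖v‖ ^ 2 / 2 := by
      rw [norm_add_sq_real, norm_sub_sq_real, real_inner_comm]
      ring
    rw [e1, e2, gaussian, gaussian, ← Real.exp_add, e3, phase, Complex.ofReal_exp,
      ← Complex.exp_add, ← Complex.exp_add]
    congr 1
    push_cast
    ring
  have e4 : -(‖a‖ ^ 2 / 2) - ‖u + a‖ ^ 2 / 2 = -‖u‖ ^ 2 / 4 + -‖u + (a + a)‖ ^ 2 / 4 := by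
    rw [norm_add_sq_real, norm_add_sq_real u (a + a), norm_add_sq_real a a, inner_add_right,
      real_inner_self_eq_norm_sq]
    ring
  simp_rw [key]
  rw [integral_const_mul, GaussianFourier.integral_cexp_neg_mul_sq_norm_add (by norm_num),
    gaussian, gaussian, mul_assoc (gaussianMass V), ← Complex.ofReal_mul, ← Real.exp_add, ← e4,
    gaussianMass, mul_left_comm, ← Complex.exp_add, Complex.ofReal_exp, J.norm_map]
  congr 2
  push_cast
  rw [Complex.I_sq]
  ring

end Gaussian

/-! ### The vacuum vector of a Weyl system -/

section WeylSystem

variable {V : Type*} [NormedAddCommGroup V] [InnerProductSpace ℝ V]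
  {H : Type*} [NormedAddCommGroup H] [InnerProductSpace ℂ H]

/-- A strongly continuous projective unitary representation `T` of `V` with the Weyl relations for
the symplectic form `(v, w) ↦ ⟪J v, w⟫`, where `J` is a skew-adjoint isometry. -/
structure IsWeylSystem (J : V →ₗᵢ[ℝ] V) (T : V → H →L[ℂ] H) : Prop where
  skew : ∀ v w : V, inner ℝ (J v) w = -inner ℝ v (J w)
  zero_apply : ∀ x, T 0 x = x
  inner_apply_left : ∀ v x y, inner ℂ (T v x) y = inner ℂ x (T (-v) y)
  apply_apply : ∀ v w x, T v (T w x) = phase (inner ℝ (J v) w) • T (v + w) x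
  continuous_apply : ∀ x, Continuous fun v => T v x

/-- The Gaussian average `∫ exp(-‖v‖² / 4) T(v) x dv`. As a function of `x` it is a multiple of the
projection onto the vacuum vectors. -/
noncomputable def gaussianAverage [MeasurableSpace V] [BorelSpace V] [FiniteDimensional ℝ V]
    (T : V → H →L[ℂ] H) (x : H) : H :=
  ∫ v : V, (gaussian v : ℂ) • T v x

namespace IsWeylSystem

variable {J : V →ₗᵢ[ℝ] V} {T : V → H →L[ℂ] H}

lemma inner_self_map (hT : IsWeylSystem J T) (v : V) : inner ℝ (J v) v = 0 := by
  have := hT.skew v v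
  rw [real_inner_comm v (J v)] at this
  rw [real_inner_comm]
  linarith

lemma norm_apply (hT : IsWeylSystem J T) (v : V) (x : H) : ‖T v x‖ = ‖x‖ := by
  have h : inner ℂ (T v x) (T v x) = inner ℂ x x := by
    rw [hT.inner_apply_left, hT.apply_apply, neg_add_cancel, hT.zero_apply, map_neg,
      inner_neg_left, hT.inner_self_map, neg_zero, phase_zero, one_smul]
  rw [@norm_eq_sqrt_re_inner ℂ, @norm_eq_sqrt_re_inner ℂ, h]

variable [FiniteDimensional ℝ V] [MeasurableSpace V] [BorelSpace V]

lemma integrable_gaussian_smul (hT : IsWeylSystem J T) (x : H) :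
    Integrable fun v : V => (gaussian v : ℂ) • T v x := by
  refine (integrable_gaussian (V := V)).mul_const ‖x‖ |>.mono'
    (Continuous.aestronglyMeasurable ?_) (Filter.Eventually.of_forall fun v => ?_)
  · exact (Complex.continuous_ofReal.comp continuous_gaussian).smul (hT.continuous_apply x)
  · rw [norm_smul, hT.norm_apply, Complex.norm_real, Real.norm_of_nonneg (gaussian_pos v).le]

/-- The vacuum projection is symmetric. -/
lemma inner_gaussianAverage_left [CompleteSpace H] (hT : IsWeylSystem J T) (x y : H) :
    inner ℂ (gaussianAverage T x) y = inner ℂ x (gaussianAverage T y) := by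
  have h1 : inner ℂ (gaussianAverage T x) y = ∫ v : V, (gaussian v : ℂ) * inner ℂ x (T (-v) y) := by
    rw [← inner_conj_symm, gaussianAverage, ← integral_inner (hT.integrable_gaussian_smul x),
      ← integral_conj]
    refine integral_congr_ae (Filter.Eventually.of_forall fun v => ?_)
    simp only [inner_conj_symm]
    rw [inner_smul_left, Complex.conj_ofReal, hT.inner_apply_left]
  have h2 : inner ℂ x (gaussianAverage T y) = ∫ v : V, (gaussian v : ℂ) * inner ℂ x (T v y) := by
    rw [gaussianAverage, ← integral_inner (hT.integrable_gaussian_smul y)]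
    simp only [inner_smul_right]
  rw [h1, h2, ← integral_neg_eq_self]
  simp only [gaussian_neg, neg_neg]

/-- Von Neumann's identity `P T(u) P = c exp(-‖u‖² / 4) P` for the Gaussian average `P`. -/
lemma gaussianAverage_apply_gaussianAverage [CompleteSpace H] (hT : IsWeylSystem J T)
    (u : V) (x : H) :
    gaussianAverage T (T u (gaussianAverage T x)) =
      (gaussianMass V * gaussian u) • gaussianAverage T x := by
  let k : V → V → ℂ := fun v s => ((gaussian v * gaussian (s - u - v) : ℝ) : ℂ) *
    phase (inner ℝ (J v) u + inner ℝ (J (v + u)) (s - u - v))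
  have h1 : ∀ v : V, (gaussian v : ℂ) • T v (T u (gaussianAverage T x)) =
      ∫ s : V, k v s • T s x := by
    intro v
    have e : (gaussian v : ℂ) • T v (T u (gaussianAverage T x)) =
        ∫ w : V, (((gaussian v * gaussian w : ℝ) : ℂ) *
          phase (inner ℝ (J v) u + inner ℝ (J (v + u)) w)) • T (v + u + w) x := by
      rw [hT.apply_apply, gaussianAverage,
        ← ContinuousLinearMap.integral_comp_comm _ (hT.integrable_gaussian_smul x),
        ← integral_smul, ← integral_smul]
      refine integral_congr_ae (Filter.Eventually.of_forall fun w => ?_)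
      simp only [map_smul, hT.apply_apply, smul_smul, phase_add]
      congr 1
      push_cast
      ring
    rw [e, ← integral_sub_right_eq_self _ (v + u)]
    refine integral_congr_ae (Filter.Eventually.of_forall fun s => ?_)
    have e1 : s - (v + u) = s - u - v := by abel
    have e2 : v + u + (s - u - v) = s := by abel
    simp only [k, e1, e2]
  have hint : Integrable (Function.uncurry fun v s : V => k v s • T s x)
      (volume.prod volume) := by
    have hb : Integrable (fun p : V × V => gaussian p.1 * gaussian (p.2 - u - p.1) * ‖x‖)
        (volume.prod volume) := by
      have h := ((integrable_gaussian (V := V)).convolution_integrand (μ := volume)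
        (ContinuousLinearMap.mul ℝ ℝ) ((integrable_gaussian (V := V)).comp_sub_right u)).swap
      refine (h.mul_const ‖x‖).congr (Filter.Eventually.of_forall fun p => ?_)
      simp [sub_right_comm]
    refine hb.mono' (Continuous.aestronglyMeasurable ?_) (Filter.Eventually.of_forall fun p => ?_)
    · have hJc := J.continuous
      have hT2 : Continuous fun p : V × V => T p.2 x := (hT.continuous_apply x).comp continuous_snd
      have hg := continuous_gaussian (V := V)
      have hp := continuous_phase
      simp only [Function.uncurry_def, k]
      refine Continuous.smul (Continuous.mul ?_ (hp.comp ?_)) hT2 <;> fun_prop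
    · simp only [Function.uncurry, k]
      rw [norm_smul, norm_mul, norm_phase, hT.norm_apply, mul_one, Complex.norm_real,
        Real.norm_of_nonneg (mul_pos (gaussian_pos _) (gaussian_pos _)).le]
  rw [gaussianAverage]
  simp_rw [h1]
  rw [integral_integral_swap hint, gaussianAverage, ← integral_smul]
  refine integral_congr_ae (Filter.Eventually.of_forall fun s => ?_)
  simp only [k]
  rw [integral_smul_const, integral_gaussian_mul_gaussian_mul_phase J hT.skew, smul_smul]

/-- The Gaussian average is not zero: conjugating it by `T u` multiplies its density by the
character `v ↦ exp(i ⟪J u, v⟫)`, and a continuous density whose Fourier transform vanishes is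
zero. -/
lemma exists_gaussianAverage_ne_zero [CompleteSpace H] [Nontrivial H] (hT : IsWeylSystem J T) :
    ∃ x, gaussianAverage T x ≠ 0 := by
  by_contra! h0
  obtain ⟨x, hx⟩ := exists_ne (0 : H)
  set f : V → H := fun v => (gaussian v : ℂ) • T v x with hf
  have hfi : Integrable f := hT.integrable_gaussian_smul x
  have hfc : Continuous f :=
    (Complex.continuous_ofReal.comp continuous_gaussian).smul (hT.continuous_apply x)
  have hF : FourierTransform.fourier f = 0 := by
    ext ξ
    -- `J` is onto by finite dimension, so that every frequency is of the form `J u`.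
    obtain ⟨u, hu⟩ := (J.toLinearIsometryEquiv rfl).surjective (-(2 * Real.pi) • ξ)
    replace hu : J u = -(2 * Real.pi) • ξ := hu
    have h1 := congrArg (T (-u)) (h0 (T u x))
    rw [map_zero, gaussianAverage,
      ← ContinuousLinearMap.integral_comp_comm _ (hT.integrable_gaussian_smul _)] at h1
    rw [Real.fourier_eq', Pi.zero_apply, ← h1]
    refine integral_congr_ae (Filter.Eventually.of_forall fun v => ?_)
    have e1 : inner ℝ (J v) u = 2 * Real.pi * inner ℝ v ξ := by
      rw [hT.skew, hu, inner_smul_right]; ring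
    have e2 : inner ℝ (J (-u)) (v + u) = 2 * Real.pi * inner ℝ v ξ := by
      rw [map_neg, inner_neg_left, inner_add_right, hT.inner_self_map, hu, real_inner_comm,
        inner_smul_right]
      ring
    simp only [hf, map_smul, hT.apply_apply, smul_smul, e1, e2]
    rw [neg_add_cancel_comm_assoc, mul_assoc (gaussian v : ℂ), ← phase_add,
      mul_comm _ (gaussian v : ℂ), phase]
    congr 3
    push_cast
    ring
  have h2 := hfc.fourierInv_fourier_eq hfi (by rw [hF]; exact integrable_zero _ _ _)
  have h3 := congrFun h2 0
  rw [hF, Real.fourierInv_eq] at h3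
  simp [hf, gaussian_zero, hT.zero_apply] at h3
  exact hx h3.symm

/-- Every Weyl system on a nonzero Hilbert space contains a vacuum vector. -/
theorem exists_vacuum [CompleteSpace H] [Nontrivial H] (hT : IsWeylSystem J T) :
    ∃ Ω : H, Ω ≠ 0 ∧ ∀ u, inner ℂ Ω (T u Ω) = gaussian u := by
  obtain ⟨x, hx⟩ := hT.exists_gaussianAverage_ne_zero
  set y := gaussianAverage T x with hy
  have h1 : ∀ u, inner ℂ y (T u y) = gaussian u * inner ℂ y y := by
    have h2 : ∀ u, inner ℂ y (T u y) = gaussian u * (gaussianMass V * inner ℂ x y) := by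
      intro u
      rw [hy, hT.inner_gaussianAverage_left, hT.gaussianAverage_apply_gaussianAverage,
        inner_smul_right]
      ring
    intro u
    have h3 := h2 0
    rw [hT.zero_apply, gaussian_zero, Complex.ofReal_one, one_mul] at h3
    rw [h2, h3]
  have hn : (‖y‖ : ℂ) ≠ 0 := by exact_mod_cast norm_ne_zero_iff.2 hx
  refine ⟨(‖y‖⁻¹ : ℂ) • y, smul_ne_zero (inv_ne_zero hn) hx, fun u => ?_⟩
  have h4 : inner ℂ y y = (‖y‖ : ℂ) ^ 2 := inner_self_eq_norm_sq_to_K y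
  rw [map_smul, inner_smul_left, inner_smul_right, h1, h4, map_inv₀, Complex.conj_ofReal]
  field_simp

end IsWeylSystem

end WeylSystem

/-! ### Representations of the Weyl algebra as Weyl systems -/

section WeylAlgebra

variable {d : ℕ}

/-- The phase space with its Euclidean norm (`PhaseSpace d` itself carries the supremum of the
norms of the two components). -/
abbrev EuclideanPhaseSpace (d : ℕ) : Type :=
  WithLp 2 (EuclideanSpace ℝ (Fin d) × EuclideanSpace ℝ (Fin d))

/-- The complex structure `(α, β) ↦ (-β, α)`, which represents the symplectic form in terms of the
inner product. -/
noncomputable def complexStructure (d : ℕ) :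
    EuclideanPhaseSpace d →ₗᵢ[ℝ] EuclideanPhaseSpace d where
  toFun v := WithLp.toLp 2 (-v.snd, v.fst)
  map_add' v w := by 
    refine (WithLp.ofLp_injective 2) (Prod.ext ?_ ?_) <;> simp [add_comm]
  map_smul' c v := by
    refine (WithLp.ofLp_injective 2) (Prod.ext ?_ ?_) <;> simp
  norm_map' v := by
    rw [← sq_eq_sq₀ (norm_nonneg _) (norm_nonneg _), WithLp.prod_norm_sq_eq_of_L2,
      WithLp.prod_norm_sq_eq_of_L2]
    simp [add_comm]

lemma inner_complexStructure (v w : EuclideanPhaseSpace d) :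
    inner ℝ (complexStructure d v) w = symplecticForm v.ofLp w.ofLp := by
  rw [WithLp.prod_inner_apply]
  simp only [complexStructure, symplecticForm, LinearIsometry.coe_mk, LinearMap.coe_mk,
    AddHom.coe_mk, inner_neg_left]
  rw [real_inner_comm w.ofLp.1, neg_add_eq_sub]
  rfl

lemma symplecticForm_comm (v w : PhaseSpace d) : symplecticForm v w = -symplecticForm w v := by
  simp [symplecticForm]

variable {A : Type*} [CStarAlgebra A] {W : PhaseSpace d → A}
  {H : Type*} [NormedAddCommGroup H] [InnerProductSpace ℂ H] [CompleteSpace H]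

lemma IsWeylAlgebra.weyl_zero (hW : IsWeylAlgebra W) : W 0 = 1 := by
  have h : ∀ a : A, W 0 * a = a := by
    have hcl : IsClosed {a : A | W 0 * a = a} :=
      isClosed_eq (continuous_const.mul continuous_id) continuous_id
    refine fun a => hcl.closure_subset_iff.2 (fun b hb => ?_) (hW.dense_span a)
    induction hb using Submodule.span_induction with
    | mem b hb =>
      obtain ⟨v, rfl⟩ := hb
      simp [hW.weyl_mul, symplecticForm]
    | zero => simp
    | add b c _ _ hb hc => exact (mul_add _ _ _).trans (congrArg₂ _ hb hc)
    | smul c b _ hb => exact (mul_smul_comm _ _ _).trans (congrArg _ hb)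
  simpa using h 1

theorem IsWeylAlgebra.isWeylSystem (hW : IsWeylAlgebra W) {π : A →⋆ₐ[ℂ] (H →L[ℂ] H)}
    (hπ : IsRegularRep W π) :
    IsWeylSystem (complexStructure d) fun v => π (W v.ofLp) where
  skew v w := by
    rw [real_inner_comm _ v, inner_complexStructure, inner_complexStructure, symplecticForm_comm]
  zero_apply x := by simp [hW.weyl_zero]
  inner_apply_left v x y := by
    rw [WithLp.ofLp_neg, ← hW.star_weyl, map_star, ContinuousLinearMap.star_eq_adjoint,
      ContinuousLinearMap.adjoint_inner_right]
  apply_apply v w x := by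
    rw [← mul_apply_eq_comp, ← map_mul, hW.weyl_mul, map_smul,
      inner_complexStructure]
    rfl
  continuous_apply x := (hπ x).comp (WithLp.prod_continuous_ofLp 2 _ _)

theorem IsWeylAlgebra.exists_vacuum (hW : IsWeylAlgebra W) {π : A →⋆ₐ[ℂ] (H →L[ℂ] H)}
    (hπ : IsIrreducibleRep π) (hπ_reg : IsRegularRep W π) :
    ∃ Ω : H, Ω ≠ 0 ∧ ∀ u, inner ℂ Ω (π (W u) Ω) = gaussian (WithLp.toLp 2 u) := by
  have := hπ.1
  obtain ⟨Ω, h0, h⟩ := (hW.isWeylSystem hπ_reg).exists_vacuum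
  exact ⟨Ω, h0, fun u => h (WithLp.toLp 2 u)⟩

end WeylAlgebra

theorem mainTheorem1 (d : ℕ)
    {A : Type*} [CStarAlgebra A] (W : PhaseSpace d → A) (hW : IsWeylAlgebra W)
    {H : Type*} [NormedAddCommGroup H] [InnerProductSpace ℂ H] [CompleteSpace H]
    {K : Type*} [NormedAddCommGroup K] [InnerProductSpace ℂ K] [CompleteSpace K]
    (π : A →⋆ₐ[ℂ] (H →L[ℂ] H)) (φ : A →⋆ₐ[ℂ] (K →L[ℂ] K))
    (hπ : IsIrreducibleRep π) (hπ_reg : IsRegularRep W π)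
    (hφ : IsIrreducibleRep φ) (hφ_reg : IsRegularRep W φ) :
    UnitarilyEquivalent π φ := by
  obtain ⟨Ω, hΩ, hΩW⟩ := hW.exists_vacuum hπ hπ_reg
  obtain ⟨Ψ, hΨ, hΨW⟩ := hW.exists_vacuum hφ hφ_reg
  refine unitarilyEquivalent_of_vectorState_eq (hπ.denseRange_orbitMap hΩ)
    (hφ.denseRange_orbitMap hΨ) fun a => ?_
  have hπc : Continuous fun a => π a Ω := (continuous_rep π).clm_apply continuous_const
  have hφc : Continuous fun a => φ a Ψ := (continuous_rep φ).clm_apply continuous_const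
  have hcl : IsClosed {a : A | inner ℂ Ω (π a Ω) = inner ℂ Ψ (φ a Ψ)} :=
    isClosed_eq (continuous_const.inner hπc) (continuous_const.inner hφc)
  refine hcl.closure_subset_iff.2 (fun b hb => ?_) (hW.dense_span a)
  rw [Set.mem_ofPred_eq]
  induction hb using Submodule.span_induction with
  | mem b hb =>
    obtain ⟨v, rfl⟩ := hb
    rw [hΩW, hΨW]
  | zero => simp
  | add b c _ _ hb hc =>
    simp only [map_add, add_apply, inner_add_right, hb, hc]
  | smul c b _ hb =>
    simp only [map_smul, smul_apply, inner_smul_right, hb]
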